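/- Conventions. A superring is a unital ring $R=R_{\bar 0}\oplus R_{\bar 1}$ graded by $\mathbb Z/2$, with $1\neq 0$, with $2$ a non-zerodivisor, and supercommutative: $xy=(-1)^{|x||y|}yx$ for homogeneous $x,y$. Write $\mathfrak J_R=R\cdot R_{\bar 1}$ and $\overline R=R/\mathfrak J_R$ (the superreduced ring, which is commutative); $R$ is a superdomain if $\overline R$ is an integral domain. $R$ is Noetherian if it satisfies the ascending chain condition on $\mathbb Z/2$-graded ideals. An ideal $\mathfrak m$ is maximal if $R/\mathfrak m$ is a field, and $R$ is local if it has exactly one maximal ideal. For an ideal $\mathfrak a$ put $\mathfrak a_i=\mathfrak a\cap R_i$. An ideal is regular if it contains a non-zerodivisor of $R$. For a Noetherian superring $R$ with $\mathrm{Kdim}(R_{\bar 0})<\infty$, odd elements $a_1,\dots,a_n\in R_{\bar 1}$ form a system of odd parameters of length $n$ if $\mathrm{Kdim}(R_{\bar 0})=\mathrm{Kdim}\bigl(R_{\bar 0}/\mathrm{Ann}_{R_{\bar 0}}(a_1\cdots a_n)\bigr)$ (the empty product is $1$). The Krull superdimension of $R$ is $\mathrm{Ksdim}(R)=\mathrm{Kdim}(R_{\bar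 0})\mid m$, where $m$ is the greatest length of a system of odd parameters. A Noetherian local superring $(R,\mathfrak m)$ with residue field $\Bbbk=R/\mathfrak m=R_{\bar 0}/\mathfrak m_{\bar 0}$ is regular if $$\mathrm{Ksdim}(R)=\dim_\Bbbk(\mathfrak m/\mathfrak m^2)_{\bar 0}\mid\dim_\Bbbk(\mathfrak m/\mathfrak m^2)_{\bar 1},\qquad (\mathfrak m/\mathfrak m^2)_i=\mathfrak m_i/(\mathfrak m^2)_i .$$ A discrete valuation superring is a regular local Noetherian superdomain of Krull superdimension $1\mid N$ for some integer $N\ge 0$. Theorem. Let $(R,\mathfrak m)$ be a Noetherian local superring whose maximal ideal $\mathfrak m$ is regular, i.e. contains a non-zerodivisor of $R$, and let $\Bbbk=R/\mathfrak m$. The following are equivalent: (i) $R$ is a discrete valuation superring; (ii) $\overline R$ is a discrete valuation ring, and for some $\Bbbk$-basis $\bar z_1,\dots,\bar z_s$ of $(\mathfrak m/\mathfrak m^2)_{\bar 1}$ and some odd lifts $z_1,\dots,z_s\in\mathfrak m_{\bar 1}=R_{\bar 1}$ of it, $z_1\cdots z_s\neq 0$; (iii) $\overline R$ is a discrete valuation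 ring, and for every $\Bbbk$-basis $\bar z_1,\dots,\bar z_s$ of $(\mathfrak m/\mathfrak m^2)_{\bar 1}$ and all odd lifts $z_1,\dots,z_s\in R_{\bar 1}$ of it, $z_1\cdots z_s\neq 0$. (If $s=0$, the product is $1$.) -/

import Mathlib

namespace Superring

/-- A `ZMod 2`-graded ring is supercommutative if `x * y = (-1) ^ (|x| |y|) * (y * x)` for all
homogeneous `x`, `y`. -/
class Supercommutative {R : Type*} [Ring R] (𝒜 : ZMod 2 → AddSubgroup R) [GradedRing 𝒜] :
    Prop where
  mul_comm' : ∀ (i j : ZMod 2) (x y : R), x ∈ 𝒜 i → y ∈ 𝒜 j →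
    x * y = (-1) ^ (i.val * j.val) * (y * x)

/-- The even part `R₀`, as a subring of `R`. In particular `R` is an `R₀`-module. -/
abbrev evenPart {R : Type*} [Ring R] (𝒜 : ZMod 2 → AddSubgroup R) [GradedRing 𝒜] : Subring R :=
  SetLike.GradeZero.subring 𝒜

theorem even_mul_comm {R : Type*} [Ring R] (𝒜 : ZMod 2 → AddSubgroup R) [GradedRing 𝒜]
    [Supercommutative 𝒜] {x y : R} (i : ZMod 2) (hx : x ∈ 𝒜 0) (hy : y ∈ 𝒜 i) :
    x * y = y * x := by
  simpa using Supercommutative.mul_comm' 0 i x y hx hy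

/-- `R₀` is a commutative ring. -/
instance evenPart.commRing {R : Type*} [Ring R] (𝒜 : ZMod 2 → AddSubgroup R) [GradedRing 𝒜]
    [Supercommutative 𝒜] : CommRing (evenPart 𝒜) :=
  { (inferInstance : Ring (evenPart 𝒜)) with
    mul_comm := fun x y => Subtype.ext (even_mul_comm 𝒜 0 x.2 y.2) }

theorem decompose_two {R : Type*} [Ring R] (𝒜 : ZMod 2 → AddSubgroup R) [GradedRing 𝒜] (x : R) :
    ∃ a ∈ 𝒜 0, ∃ b ∈ 𝒜 1, x = a + b := by
  classical
  refine ⟨_, (DirectSum.decompose 𝒜 x 0).2, _, (DirectSum.decompose 𝒜 x 1).2, ?_⟩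
  conv_lhs => rw [← DirectSum.sum_support_decompose 𝒜 x]
  rw [Finset.sum_subset (Finset.subset_univ _)]
  · exact Fin.sum_univ_two (fun i : Fin 2 => ((DirectSum.decompose 𝒜 x i : 𝒜 i) : R))
  · intro i _ hi
    simpa using hi

/-- The canonical superideal `J_R = R · R₁`. -/
def canonicalIdeal {R : Type*} [Ring R] (𝒜 : ZMod 2 → AddSubgroup R) [GradedRing 𝒜] : Ideal R :=
  Ideal.span (𝒜 1 : Set R)

instance canonicalIdeal.isTwoSided {R : Type*} [Ring R] (𝒜 : ZMod 2 → AddSubgroup R)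
    [GradedRing 𝒜] [Supercommutative 𝒜] : (canonicalIdeal 𝒜).IsTwoSided where
  mul_mem_of_left := by
    intro x y hx
    induction hx using Submodule.span_induction with
    | mem z hz =>
      obtain ⟨a, ha, b, hb, rfl⟩ := decompose_two 𝒜 y
      rw [mul_add, ← even_mul_comm 𝒜 1 ha hz]
      exact add_mem (Ideal.mul_mem_left _ _ (Ideal.subset_span hz))
        (Ideal.mul_mem_left _ _ (Ideal.subset_span hb))
    | zero => simp
    | add u v _ _ hu hv => rw [add_mul]; exact add_mem hu hv
    | smul r u _ hu => rw [smul_eq_mul, mul_assoc]; exact Ideal.mul_mem_left _ _ hu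

/-- The superreduced ring `R̄ = R / J_R`. -/
abbrev Superreduced {R : Type*} [Ring R] (𝒜 : ZMod 2 → AddSubgroup R) [GradedRing 𝒜] : Type _ :=
  R ⧸ canonicalIdeal 𝒜

/-- `R̄` is a commutative ring. -/
instance Superreduced.commRing {R : Type*} [Ring R] (𝒜 : ZMod 2 → AddSubgroup R)
    [GradedRing 𝒜] [Supercommutative 𝒜] : CommRing (Superreduced 𝒜) :=
  { (inferInstance : Ring (Superreduced 𝒜)) with
    mul_comm := by
      have key : ∀ z : R, ∃ a ∈ 𝒜 0, Ideal.Quotient.mk (canonicalIdeal 𝒜) z =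
          Ideal.Quotient.mk (canonicalIdeal 𝒜) a := by
        intro z
        obtain ⟨a, ha, b, hb, rfl⟩ := decompose_two 𝒜 z
        refine ⟨a, ha, ?_⟩
        have hbJ : b ∈ canonicalIdeal 𝒜 := Ideal.subset_span hb
        rw [map_add, Ideal.Quotient.eq_zero_iff_mem.mpr hbJ, add_zero]
      intro x y
      obtain ⟨x, rfl⟩ := Ideal.Quotient.mk_surjective x
      obtain ⟨y, rfl⟩ := Ideal.Quotient.mk_surjective y
      obtain ⟨a, ha, hxa⟩ := key x
      obtain ⟨b, hb, hyb⟩ := key y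
      change Ideal.Quotient.mk (canonicalIdeal 𝒜) x * Ideal.Quotient.mk (canonicalIdeal 𝒜) y =
        Ideal.Quotient.mk (canonicalIdeal 𝒜) y * Ideal.Quotient.mk (canonicalIdeal 𝒜) x
      rw [hxa, hyb, ← map_mul, ← map_mul, even_mul_comm 𝒜 0 ha hb] }

/-- `R` is a superdomain if `R̄` is an integral domain. -/
def IsSuperdomain {R : Type*} [Ring R] (𝒜 : ZMod 2 → AddSubgroup R) [GradedRing 𝒜]
    [Supercommutative 𝒜] : Prop :=
  IsDomain (Superreduced 𝒜)

/-- `R` is Noetherian if it has the ascending chain condition on superideals. (Homogeneous left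
ideals are the same thing as homogeneous two-sided ideals, by supercommutativity.) -/
def IsNoetherianSuperring {R : Type*} [Ring R] (𝒜 : ZMod 2 → AddSubgroup R) [GradedRing 𝒜] : Prop :=
  WellFoundedGT (HomogeneousIdeal 𝒜)

/-- A (two-sided) ideal `m` is maximal if `R / m` is a field. -/
def IsMaximalIdeal {R : Type*} [Ring R] (m : Ideal R) : Prop :=
  ∃ _ : m.IsTwoSided, IsField (R ⧸ m)

/-- `(R, m)` is local: `m` is the unique maximal ideal of `R`. -/
def IsLocalSuperring {R : Type*} [Ring R] (m : Ideal R) : Prop :=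
  IsMaximalIdeal m ∧ ∀ n : Ideal R, IsMaximalIdeal n → n = m

/-- `a` is a regular element, i.e. a non-zerodivisor on `R`: it kills no nonzero homogeneous
element. -/
def IsRegularElement {R : Type*} [Ring R] (𝒜 : ZMod 2 → AddSubgroup R) (a : R) : Prop :=
  ∀ y : R, SetLike.IsHomogeneousElem 𝒜 y → a * y = 0 → y = 0

/-- A regular ideal is one that contains a regular element. -/
def IsRegularIdeal {R : Type*} [Ring R] (𝒜 : ZMod 2 → AddSubgroup R) (I : Ideal R) : Prop :=
  ∃ a ∈ I, IsRegularElement 𝒜 a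

/-- The homogeneous component `R_i`, as an `R₀`-submodule of `R`. -/
def component {R : Type*} [Ring R] (𝒜 : ZMod 2 → AddSubgroup R) [GradedRing 𝒜] (i : ZMod 2) :
    Submodule (evenPart 𝒜) R :=
  { 𝒜 i with
    smul_mem' := fun r x hx => by
      have h := SetLike.mul_mem_graded (A := 𝒜) r.2 hx
      rwa [zero_add] at h }

/-- The homogeneous component `I_i = I ∩ R_i` of an ideal `I`, as an `R₀`-module. -/
def idealComponent {R : Type*} [Ring R] (𝒜 : ZMod 2 → AddSubgroup R) [GradedRing 𝒜]
    (I : Ideal R) (i : ZMod 2) : Submodule (evenPart 𝒜) R :=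
  I.restrictScalars (evenPart 𝒜) ⊓ component 𝒜 i

/-- `(m / m²)_i = m_i / (m²)_i`, as an `R₀`-module. -/
abbrev cotangent {R : Type*} [Ring R] (𝒜 : ZMod 2 → AddSubgroup R) [GradedRing 𝒜]
    (m : Ideal R) (i : ZMod 2) : Type _ :=
  idealComponent 𝒜 m i ⧸ (idealComponent 𝒜 (m * m) i).submoduleOf (idealComponent 𝒜 m i)

/-- The ideal `m₀ = m ∩ R₀` of `R₀`. -/
abbrev evenIdeal {R : Type*} [Ring R] (𝒜 : ZMod 2 → AddSubgroup R) [GradedRing 𝒜]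
    (m : Ideal R) : Ideal (evenPart 𝒜) :=
  m.comap (evenPart 𝒜).subtype

/-- The residue field `R₀ / m₀` (which is `R / m` for a maximal ideal `m`). -/
abbrev residueField {R : Type*} [Ring R] (𝒜 : ZMod 2 → AddSubgroup R) [GradedRing 𝒜]
    [Supercommutative 𝒜] (m : Ideal R) : Type _ :=
  evenPart 𝒜 ⧸ evenIdeal 𝒜 m

theorem cotangent_isTorsionBySet {R : Type*} [Ring R] (𝒜 : ZMod 2 → AddSubgroup R)
    [GradedRing 𝒜] (m : Ideal R) (i : ZMod 2) :
    Module.IsTorsionBySet (evenPart 𝒜) (cotangent 𝒜 m i) (evenIdeal 𝒜 m : Set (evenPart 𝒜)) := by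
  intro x r
  obtain ⟨x, rfl⟩ := Submodule.Quotient.mk_surjective _ x
  rw [← Submodule.Quotient.mk_smul, Submodule.Quotient.mk_eq_zero]
  refine ⟨Ideal.mul_mem_mul r.2 x.2.1, ?_⟩
  exact ((r : evenPart 𝒜) • x).2.2

/-- `(m / m²)_i` is a vector space over the residue field, via the action of `R₀`. -/
instance cotangent.module {R : Type*} [Ring R] (𝒜 : ZMod 2 → AddSubgroup R)
    [GradedRing 𝒜] [Supercommutative 𝒜] (m : Ideal R) (i : ZMod 2) :
    Module (residueField 𝒜 m) (cotangent 𝒜 m i) :=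
  (cotangent_isTorsionBySet 𝒜 m i).module

/-- The superdimension `sdim (m / m²) = r | s` (both numbers are finite for `R` local
Noetherian). -/
noncomputable def cotangentSdim {R : Type*} [Ring R] (𝒜 : ZMod 2 → AddSubgroup R)
    [GradedRing 𝒜] [Supercommutative 𝒜] (m : Ideal R) : ℕ × ℕ :=
  (Module.finrank (residueField 𝒜 m) (cotangent 𝒜 m 0),
    Module.finrank (residueField 𝒜 m) (cotangent 𝒜 m 1))

/-- The odd elements `a 0, …, a (n - 1)` form a system of odd parameters of length `n`:
`Kdim R₀ = Kdim (R₀ / Ann_{R₀} (a 0 ⋯ a (n - 1)))`. -/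
def IsSystemOfOddParameters {R : Type*} [Ring R] (𝒜 : ZMod 2 → AddSubgroup R) [GradedRing 𝒜]
    [Supercommutative 𝒜] {n : ℕ} (a : Fin n → R) : Prop :=
  (∀ i, a i ∈ 𝒜 1) ∧
    ringKrullDim (evenPart 𝒜) =
      ringKrullDim (evenPart 𝒜 ⧸ Ideal.torsionOf (evenPart 𝒜) R (List.ofFn a).prod)

/-- The Krull superdimension: the Krull dimension of `R₀`, and the greatest length of a system
of odd parameters. -/
noncomputable def Ksdim {R : Type*} [Ring R] (𝒜 : ZMod 2 → AddSubgroup R) [GradedRing 𝒜]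
    [Supercommutative 𝒜] : WithBot ℕ∞ × ℕ∞ :=
  (ringKrullDim (evenPart 𝒜),
    ⨆ (n : ℕ) (_ : ∃ a : Fin n → R, IsSystemOfOddParameters 𝒜 a), (n : ℕ∞))

/-- A local Noetherian superring `(R, m)` is regular if `Ksdim R = sdim (m / m²)`. -/
def IsRegularLocal {R : Type*} [Ring R] (𝒜 : ZMod 2 → AddSubgroup R) [GradedRing 𝒜]
    [Supercommutative 𝒜] (m : Ideal R) : Prop :=
  Ksdim 𝒜 = (((cotangentSdim 𝒜 m).1 : WithBot ℕ∞), ((cotangentSdim 𝒜 m).2 : ℕ∞))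

/-- A discrete valuation superring is a regular local Noetherian superdomain of Krull
superdimension `1 | N`, for some natural number `N`. -/
def IsDiscreteValuationSuperring {R : Type*} [Ring R] (𝒜 : ZMod 2 → AddSubgroup R)
    [GradedRing 𝒜] [Supercommutative 𝒜] : Prop :=
  ∃ m : Ideal R, IsLocalSuperring m ∧ IsNoetherianSuperring 𝒜 ∧ IsSuperdomain 𝒜 ∧ IsRegularLocal 𝒜 m ∧
    ∃ N : ℕ, Ksdim 𝒜 = (1, (N : ℕ∞))

/-- The odd elements `z i` of `m` lift the vectors `b i` of `(m / m²)₁`. -/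
def IsOddLift {R : Type*} [Ring R] (𝒜 : ZMod 2 → AddSubgroup R) [GradedRing 𝒜]
    [Supercommutative 𝒜] (m : Ideal R) {s : ℕ}
    (b : Module.Basis (Fin s) (residueField 𝒜 m) (cotangent 𝒜 m 1))
    (z : Fin s → idealComponent 𝒜 m 1) : Prop :=
  ∀ i, Submodule.Quotient.mk (z i) = b i

/-- `R̄` is a discrete valuation ring. -/
def SuperreducedIsDVR {R : Type*} [Ring R] (𝒜 : ZMod 2 → AddSubgroup R) [GradedRing 𝒜]
    [Supercommutative 𝒜] : Prop :=
  ∃ _ : IsDomain (Superreduced 𝒜), IsDiscreteValuationRing (Superreduced 𝒜)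

end Superring

namespace Superring

/-! ### Even and odd parts of elements and ideals. -/

section Graded

variable {R : Type*} [Ring R] (𝒜 : ZMod 2 → AddSubgroup R) [GradedRing 𝒜]

/-! Even and odd directions separate. The surjection `R₀ → R̄` has nil kernel `J ∩ R₀`, generated by
products of two odd elements, so `R₀` and `R̄` have the same Krull dimension. That kernel lies in
`m²`, so `(m/m²)₀` is the cotangent space of the local ring `R̄`; when `R̄` is a domain, it is a DVR
iff this space is a line.

On the odd side `(m²)₁ = m₀R₁`, so by Nakayama odd lifts `z₁, …, z_s` of a basis generate `R₁` over
`R₀`. Products of odd elements are alternating and `R₀`-multilinear; hence products of more than `s`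
of them vanish, and if `z₁⋯z_s = 0` so do all products of `s` (`prod_odd_eq_zero`). As a system of
odd parameters has nonzero product, its length is at most `s`, and less if `z₁⋯z_s = 0`. Regularity
therefore forces `z₁⋯z_s ≠ 0` for all lifts.

Conversely, let `z = z₁⋯z_s ≠ 0` and let `R̄` be a DVR. Then `J z = 0`. If `x z = 0` with `x` even
and nonzero in `R̄`, then `x` divides, modulo `J`, a power of a regular even `a ∈ m`, so that power
kills `z`, which is absurd. So `Ann z = J ∩ R₀`, a nil ideal, and the `zᵢ` are odd parameters
(`IsLocalSuperring.isSystemOfOddParameters`). -/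

theorem even_mul_odd_mem {x y : R} (hx : x ∈ 𝒜 0) (hy : y ∈ 𝒜 1) : x * y ∈ 𝒜 1 := by
  simpa using SetLike.mul_mem_graded (A := 𝒜) hx hy

theorem even_mul_even_mem {x y : R} (hx : x ∈ 𝒜 0) (hy : y ∈ 𝒜 0) : x * y ∈ 𝒜 0 := by
  simpa using SetLike.mul_mem_graded (A := 𝒜) hx hy

theorem odd_mul_odd_mem {x y : R} (hx : x ∈ 𝒜 1) (hy : y ∈ 𝒜 1) : x * y ∈ 𝒜 0 := by
  have h := SetLike.mul_mem_graded (A := 𝒜) hx hy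
  rwa [show (1 + 1 : ZMod 2) = 0 from by decide] at h

theorem eq_zero_of_mem_of_mem {i j : ZMod 2} (hij : i ≠ j) {x : R} (hi : x ∈ 𝒜 i)
    (hj : x ∈ 𝒜 j) : x = 0 := by
  rw [← DirectSum.decompose_of_mem_same 𝒜 hi, DirectSum.decompose_of_mem_ne 𝒜 hj hij.symm]

theorem odd_mem_canonicalIdeal {x : R} (hx : x ∈ 𝒜 1) : x ∈ canonicalIdeal 𝒜 :=
  Ideal.subset_span hx

section Superreduced

variable [Supercommutative 𝒜]

/-- The canonical map `R₀ → R̄`. -/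
def evenToSuperreduced : evenPart 𝒜 →+* Superreduced 𝒜 :=
  (Ideal.Quotient.mk (canonicalIdeal 𝒜)).comp (evenPart 𝒜).subtype

theorem evenToSuperreduced_surjective : Function.Surjective (evenToSuperreduced 𝒜) := by
  intro x
  obtain ⟨x, rfl⟩ := Ideal.Quotient.mk_surjective x
  obtain ⟨a, ha, b, hb, rfl⟩ := decompose_two 𝒜 x
  refine ⟨⟨a, ha⟩, ?_⟩
  change Ideal.Quotient.mk (canonicalIdeal 𝒜) a = _
  rw [map_add, Ideal.Quotient.eq_zero_iff_mem.mpr (odd_mem_canonicalIdeal 𝒜 hb), add_zero]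

theorem mem_ker_evenToSuperreduced {x : evenPart 𝒜} :
    x ∈ RingHom.ker (evenToSuperreduced 𝒜) ↔ (x : R) ∈ canonicalIdeal 𝒜 :=
  Ideal.Quotient.eq_zero_iff_mem

end Superreduced

/-- An even element of `J_R` is a sum of products of two odd elements. -/
theorem mem_closure_of_even_of_mem_canonicalIdeal {x : R} (hx : x ∈ 𝒜 0)
    (hJ : x ∈ canonicalIdeal 𝒜) :
    x ∈ AddSubgroup.closure {w : R | ∃ u ∈ 𝒜 1, ∃ v ∈ 𝒜 1, w = u * v} := by
  set C := AddSubgroup.closure {w : R | ∃ u ∈ 𝒜 1, ∃ v ∈ 𝒜 1, w = u * v} with hC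
  have hC0 : C ≤ 𝒜 0 := by
    rw [hC, AddSubgroup.closure_le]
    rintro _ ⟨u, hu, v, hv, rfl⟩
    exact odd_mul_odd_mem 𝒜 hu hv
  have key : ∀ y ∈ canonicalIdeal 𝒜, ∃ c ∈ C, ∃ b ∈ 𝒜 1, y = c + b := by
    intro y hy
    induction hy using Submodule.closure_induction with
    | zero => exact ⟨0, zero_mem _, 0, zero_mem _, (zero_add 0).symm⟩
    | add p q _ _ hp hq =>
      obtain ⟨c, hc, b, hb, rfl⟩ := hp
      obtain ⟨c', hc', b', hb', rfl⟩ := hq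
      exact ⟨c + c', add_mem hc hc', b + b', add_mem hb hb', by abel⟩
    | smul_mem r p hp =>
      obtain ⟨r₀, hr₀, r₁, hr₁, rfl⟩ := decompose_two 𝒜 r
      exact ⟨r₁ * p, AddSubgroup.subset_closure ⟨r₁, hr₁, p, hp, rfl⟩, r₀ * p,
        even_mul_odd_mem 𝒜 hr₀ hp, by rw [smul_eq_mul, add_mul, add_comm]⟩
  obtain ⟨c, hc, b, hb, rfl⟩ := key x hJ
  have hb0 : b ∈ 𝒜 0 := by simpa using sub_mem hx (hC0 hc)
  rwa [eq_zero_of_mem_of_mem 𝒜 (by decide) hb0 hb, add_zero]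

/-- The homogeneous part of a span of elements of degree `i`. -/
theorem mem_of_mem_span_component {i : ZMod 2} {N : Submodule (evenPart 𝒜) R}
    (hN : N ≤ component 𝒜 i) {x : R} (hx : x ∈ 𝒜 i) (hxN : x ∈ Ideal.span (N : Set R)) :
    x ∈ N := by
  have key : ∀ y ∈ Ideal.span (N : Set R), ∃ c ∈ N, ∃ b ∈ 𝒜 (1 + i), y = c + b := by
    intro y hy
    induction hy using Submodule.closure_induction with
    | zero => exact ⟨0, zero_mem _, 0, zero_mem _, (zero_add 0).symm⟩
    | add p q _ _ hp hq =>
      obtain ⟨c, hc, b, hb, rfl⟩ := hp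
      obtain ⟨c', hc', b', hb', rfl⟩ := hq
      exact ⟨c + c', add_mem hc hc', b + b', add_mem hb hb', by abel⟩
    | smul_mem r p hp =>
      obtain ⟨r₀, hr₀, r₁, hr₁, rfl⟩ := decompose_two 𝒜 r
      exact ⟨r₀ * p, N.smul_mem ⟨r₀, hr₀⟩ hp, r₁ * p, SetLike.mul_mem_graded hr₁ (hN hp),
        by rw [smul_eq_mul, add_mul]⟩
  obtain ⟨c, hc, b, hb, rfl⟩ := key x hxN
  have hb0 : b ∈ 𝒜 i := by simpa using sub_mem hx (show c ∈ 𝒜 i from hN hc)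
  have hi : i ≠ 1 + i := by
    clear * -
    revert i
    decide
  rwa [eq_zero_of_mem_of_mem 𝒜 hi hb0 hb, add_zero]

end Graded

/-! ### Nil ideals, units and dimension. -/

theorem isUnit_of_isUnit_map_of_ker_le_nilradical {A B : Type*} [CommRing A] [CommRing B]
    {f : A →+* B} (hf : Function.Surjective f) (hker : RingHom.ker f ≤ nilradical A) {x : A}
    (hx : IsUnit (f x)) : IsUnit x := by
  obtain ⟨y, hy⟩ := hf (↑hx.unit⁻¹ : B)
  have hk : x * y - 1 ∈ RingHom.ker f := by
    rw [RingHom.mem_ker, map_sub, map_mul, hy, map_one, IsUnit.mul_val_inv, sub_self]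
  have hu := (mem_nilradical.mp (hker hk)).isUnit_one_add
  rw [add_sub_cancel] at hu
  exact isUnit_of_mul_isUnit_left hu

theorem ringKrullDim_quotient_of_le_nilradical {A : Type*} [CommRing A] {I : Ideal A}
    (hI : I ≤ nilradical A) : ringKrullDim (A ⧸ I) = ringKrullDim A := by
  rw [ringKrullDim_quotient, show PrimeSpectrum.zeroLocus (I : Set A) = Set.univ from ?_]
  · exact Order.krullDim_eq_of_orderIso OrderIso.Set.univ
  · refine Set.eq_univ_of_forall fun p => ?_
    exact hI.trans (nilradical_le_prime p.asIdeal)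

/-! ### Products of odd elements. -/

section Odd

variable {R : Type*} [Ring R] (𝒜 : ZMod 2 → AddSubgroup R) [GradedRing 𝒜] [Supercommutative 𝒜]

theorem odd_mul_odd_comm {x y : R} (hx : x ∈ 𝒜 1) (hy : y ∈ 𝒜 1) : x * y = -(y * x) := by
  have h := Supercommutative.mul_comm' 1 1 x y hx hy
  rwa [show (1 : ZMod 2).val = 1 from rfl, one_mul, pow_one, neg_one_mul] at h

variable (h2 : ∀ x : R, 2 * x = 0 → x = 0)
include h2

theorem odd_mul_self {x : R} (hx : x ∈ 𝒜 1) : x * x = 0 := by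
  refine h2 _ ?_
  rw [two_mul]
  nth_rw 1 [odd_mul_odd_comm 𝒜 hx hx]
  exact neg_add_cancel _

/-- The kernel consists of sums of products `u * v` of odd elements, and each such product squares
to zero. -/
theorem ker_evenToSuperreduced_le_nilradical :
    RingHom.ker (evenToSuperreduced 𝒜) ≤ nilradical (evenPart 𝒜) := by
  intro x hx
  have hx' := mem_closure_of_even_of_mem_canonicalIdeal 𝒜 x.2
    ((mem_ker_evenToSuperreduced 𝒜).mp hx)
  suffices h : ∀ w ∈ AddSubgroup.closure {w : R | ∃ u ∈ 𝒜 1, ∃ v ∈ 𝒜 1, w = u * v},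
      ∃ c ∈ nilradical (evenPart 𝒜), (c : R) = w by
    obtain ⟨c, hc, hcx⟩ := h _ hx'
    rwa [← Subtype.ext hcx]
  intro w hw
  induction hw using AddSubgroup.closure_induction with
  | mem w hw =>
    obtain ⟨u, hu, v, hv, rfl⟩ := hw
    refine ⟨⟨u * v, odd_mul_odd_mem 𝒜 hu hv⟩, ⟨2, Subtype.ext ?_⟩, rfl⟩
    change (u * v) ^ 2 = 0
    rw [pow_two, mul_assoc, ← mul_assoc v, odd_mul_odd_comm 𝒜 hv hu, neg_mul, mul_assoc,
      odd_mul_self 𝒜 h2 hv, mul_zero, neg_zero, mul_zero]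
  | zero => exact ⟨0, zero_mem _, rfl⟩
  | add p q _ _ hp hq =>
    obtain ⟨c, hc, rfl⟩ := hp
    obtain ⟨d, hd, rfl⟩ := hq
    exact ⟨c + d, add_mem hc hd, rfl⟩
  | neg p _ hp =>
    obtain ⟨c, hc, rfl⟩ := hp
    exact ⟨-c, neg_mem hc, rfl⟩

theorem ringKrullDim_evenPart_quotient_ker :
    ringKrullDim (evenPart 𝒜 ⧸ RingHom.ker (evenToSuperreduced 𝒜)) =
      ringKrullDim (evenPart 𝒜) :=
  ringKrullDim_quotient_of_le_nilradical (ker_evenToSuperreduced_le_nilradical 𝒜 h2)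

theorem ringKrullDim_superreduced :
    ringKrullDim (Superreduced 𝒜) = ringKrullDim (evenPart 𝒜) := by
  rw [← ringKrullDim_evenPart_quotient_ker 𝒜 h2]
  exact (ringKrullDim_eq_of_ringEquiv
    (RingHom.quotientKerEquivOfSurjective (evenToSuperreduced_surjective 𝒜))).symm

/-- The product of `n` odd elements, as an alternating `R₀`-multilinear map. -/
theorem exists_alternatingMap_prod (n : ℕ) :
    ∃ F : component 𝒜 1 [⋀^Fin n]→ₗ[evenPart 𝒜] R,
      ∀ v, F v = (List.ofFn fun i => (v i : R)).prod := by
  let _ : Algebra (evenPart 𝒜) R := Algebra.ofModule (fun r x y => mul_assoc (r : R) x y)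
    (fun r x y => by
      obtain ⟨a, ha, b, hb, rfl⟩ := decompose_two 𝒜 x
      change (a + b) * ((r : R) * y) = r * ((a + b) * y)
      rw [← mul_assoc, ← mul_assoc, mul_add, add_mul a b, even_mul_comm 𝒜 0 r.2 ha,
        even_mul_comm 𝒜 1 r.2 hb])
  -- Odd elements square to zero, so the inclusion of `R₁` extends to the exterior algebra over the
  -- central subring `R₀`.
  let f := ExteriorAlgebra.lift (evenPart 𝒜)
    ⟨(component 𝒜 1).subtype, fun x => odd_mul_self 𝒜 h2 x.2⟩
  refine ⟨f.toLinearMap.compAlternatingMap (ExteriorAlgebra.ιMulti (evenPart 𝒜) n), fun v => ?_⟩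
  rw [LinearMap.compAlternatingMap_apply, ExteriorAlgebra.ιMulti_apply, AlgHom.toLinearMap_apply,
    map_list_prod, List.map_ofFn]
  congr 2
  funext i
  exact ExteriorAlgebra.lift_ι_apply _ _ _ _

variable {𝒜} in
/-- If `z₁, …, z_s` generate `R₁` and `n > s`, or `n = s` and `z₁ ⋯ z_s = 0`, then every product
of `n` odd elements vanishes. -/
theorem prod_odd_eq_zero {s n : ℕ} {z : Fin s → component 𝒜 1}
    (hz : Submodule.span (evenPart 𝒜) (Set.range z) = ⊤) (hsn : s ≤ n)
    (hz0 : s = n → (List.ofFn fun i => (z i : R)).prod = 0) (a : Fin n → component 𝒜 1) :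
    (List.ofFn fun i => (a i : R)).prod = 0 := by
  obtain ⟨F, hF⟩ := exists_alternatingMap_prod 𝒜 h2 n
  have hc : ∀ i, ∃ c : Fin s → evenPart 𝒜, ∑ j, c j • z j = a i := fun i =>
    (Submodule.mem_span_range_iff_exists_fun _).mp (hz ▸ Submodule.mem_top)
  choose c hc using hc
  rw [← hF, ← funext hc]
  -- Multilinear expansion runs over index maps `r : Fin n → Fin s`. A repeated index gives zero; an
  -- injective `r` forces `s = n` and gives `± z₁⋯z_s`.
  have hexp := F.toMultilinearMap.map_sum (fun i j => c i j • z j)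
  refine hexp.trans (Finset.sum_eq_zero fun r _ => ?_)
  change F (fun i => c i (r i) • z (r i)) = 0
  rw [AlternatingMap.map_smul_univ, show F (fun i => z (r i)) = 0 from ?_, smul_zero]
  by_cases hr : Function.Injective r
  · have hs : s = n := le_antisymm hsn (by simpa using Fintype.card_le_of_injective r hr)
    subst hs
    have h := F.map_perm z (Equiv.ofBijective r (Finite.injective_iff_bijective.mp hr))
    rw [hF z, hz0 rfl, smul_zero] at h
    exact h
  · simp only [Function.Injective, not_forall] at hr
    obtain ⟨i, j, hij, hne⟩ := hr
    exact F.map_eq_zero_of_eq _ (by rw [hij]) hne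

end Odd

/-! ### Noetherianity of the components and of `R̄`. -/

section Noetherian

variable {R : Type*} [Ring R] (𝒜 : ZMod 2 → AddSubgroup R) [GradedRing 𝒜]

/-- A submodule of `R_i` is recovered as the degree `i` part of the homogeneous ideal it spans, so
strict chains of submodules give strict chains of superideals. -/
theorem isNoetherian_component (hN : IsNoetherianSuperring 𝒜) (i : ZMod 2) :
    IsNoetherian (evenPart 𝒜) (component 𝒜 i) := by
  have hN' : WellFoundedGT (HomogeneousIdeal 𝒜) := hN
  rw [isNoetherian_iff']
  have hle : ∀ N : Submodule (evenPart 𝒜) (component 𝒜 i),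
      N.map (component 𝒜 i).subtype ≤ component 𝒜 i := fun N => Submodule.map_subtype_le _ _
  let f : Submodule (evenPart 𝒜) (component 𝒜 i) → HomogeneousIdeal 𝒜 := fun N =>
    ⟨Ideal.span (N.map (component 𝒜 i).subtype : Set R),
      Ideal.homogeneous_span 𝒜 _ fun x hx => ⟨i, hle N hx⟩⟩
  have hf : ∀ N N', f N ≤ f N' → N ≤ N' := by
    intro N N' h x hx
    have h1 : (x : R) ∈ Ideal.span (N'.map (component 𝒜 i).subtype : Set R) :=
      h (Ideal.subset_span (Submodule.mem_map_of_mem hx))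
    obtain ⟨y, hy, hyx⟩ := mem_of_mem_span_component 𝒜 (hle N') x.2 h1
    rwa [← Subtype.ext hyx]
  have hmono : Monotone f := fun N N' h => Ideal.span_mono (Submodule.map_mono h)
  exact (hmono.strictMono_of_injective fun N N' h =>
    le_antisymm (hf _ _ h.le) (hf _ _ h.ge)).wellFoundedGT

variable [Supercommutative 𝒜]

theorem isNoetherianRing_superreduced (hN : IsNoetherianSuperring 𝒜) :
    IsNoetherianRing (Superreduced 𝒜) := by
  have hN' : WellFoundedGT (HomogeneousIdeal 𝒜) := hN
  rw [isNoetherianRing_iff, isNoetherian_iff']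
  let f : Ideal (Superreduced 𝒜) → HomogeneousIdeal 𝒜 := fun I =>
    ⟨I.comap (Ideal.Quotient.mk (canonicalIdeal 𝒜)), by
      intro i x hx
      -- The preimage contains every odd element, which makes it homogeneous.
      have hJ : ∀ b ∈ 𝒜 1, b ∈ I.comap (Ideal.Quotient.mk (canonicalIdeal 𝒜)) := fun b hb => by
        rw [Ideal.mem_comap, Ideal.Quotient.eq_zero_iff_mem.mpr (odd_mem_canonicalIdeal 𝒜 hb)]
        exact zero_mem _
      obtain ⟨a, ha, b, hb, rfl⟩ := decompose_two 𝒜 x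
      have ha' : a ∈ I.comap (Ideal.Quotient.mk (canonicalIdeal 𝒜)) := by
        simpa using sub_mem hx (hJ b hb)
      rw [DirectSum.decompose_add, DirectSum.add_apply, AddSubgroup.coe_add]
      have hi : i = 0 ∨ i = 1 := by
        clear * -
        revert i
        decide
      rcases hi with rfl | rfl
      · rwa [DirectSum.decompose_of_mem_same 𝒜 ha,
          DirectSum.decompose_of_mem_ne 𝒜 hb (by decide), add_zero]
      · rw [DirectSum.decompose_of_mem_same 𝒜 hb,
          DirectSum.decompose_of_mem_ne 𝒜 ha (by decide), zero_add]
        exact hJ b hb⟩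
  have hmono : Monotone f := fun I I' h => Ideal.comap_mono h
  refine (hmono.strictMono_of_injective fun I I' h => ?_).wellFoundedGT
  exact Ideal.comap_injective_of_surjective (Ideal.Quotient.mk (canonicalIdeal 𝒜))
    Ideal.Quotient.mk_surjective (congrArg HomogeneousIdeal.toIdeal h)

end Noetherian

/-! ### Local superrings. -/

section Local

variable {R : Type*} [Ring R] {𝒜 : ZMod 2 → AddSubgroup R} [GradedRing 𝒜] [Supercommutative 𝒜]
  {m : Ideal R}

theorem IsLocalSuperring.one_notMem (hm : IsLocalSuperring m) : (1 : R) ∉ m := by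
  obtain ⟨⟨_, hF⟩, -⟩ := hm
  intro h
  have := hF.nontrivial
  exact one_ne_zero (α := R ⧸ m) (Ideal.Quotient.eq_zero_iff_mem.mpr h)

/-- The quotient of `R` by the preimage is `R̄ / M`, a field, so uniqueness of `m` applies. This
transfers locality to `R̄`. -/
theorem IsLocalSuperring.comap_eq (hm : IsLocalSuperring m) (M : Ideal (Superreduced 𝒜))
    (hM : M.IsMaximal) : M.comap (Ideal.Quotient.mk (canonicalIdeal 𝒜)) = m := by
  have hts : (M.comap (Ideal.Quotient.mk (canonicalIdeal 𝒜))).IsTwoSided := ⟨by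
    intro x y hx
    rw [Ideal.mem_comap, map_mul]
    exact M.mul_mem_right _ hx⟩
  refine hm.2 _ ⟨hts, ?_⟩
  let g : R →+* Superreduced 𝒜 ⧸ M :=
    (Ideal.Quotient.mk M).comp (Ideal.Quotient.mk (canonicalIdeal 𝒜))
  have hker : RingHom.ker g = M.comap (Ideal.Quotient.mk (canonicalIdeal 𝒜)) := by
    ext x
    rw [RingHom.mem_ker, Ideal.mem_comap]
    exact Ideal.Quotient.eq_zero_iff_mem
  have hg : Function.Surjective g :=
    Ideal.Quotient.mk_surjective.comp Ideal.Quotient.mk_surjective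
  have hF : IsField (Superreduced 𝒜 ⧸ M) := (Ideal.Quotient.maximal_ideal_iff_isField_quotient M).mp hM
  let e := (Ideal.quotEquivOfEq hker.symm).trans (RingHom.quotientKerEquivOfSurjective hg)
  exact e.toMulEquiv.isField hF

variable (h2 : ∀ x : R, 2 * x = 0 → x = 0)
include h2

theorem IsLocalSuperring.odd_mem (hm : IsLocalSuperring m) {x : R} (hx : x ∈ 𝒜 1) : x ∈ m := by
  obtain ⟨⟨_, hF⟩, -⟩ := hm
  rw [← Ideal.Quotient.eq_zero_iff_mem]
  have h : Ideal.Quotient.mk m x * Ideal.Quotient.mk m x = 0 := by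
    rw [← map_mul, odd_mul_self 𝒜 h2 hx, map_zero]
  by_contra h0
  obtain ⟨y, hy⟩ := hF.mul_inv_cancel h0
  apply h0
  calc Ideal.Quotient.mk m x
      = Ideal.Quotient.mk m x * (Ideal.Quotient.mk m x * y) := by rw [hy, mul_one]
    _ = 0 := by rw [← mul_assoc, h, zero_mul]

theorem IsLocalSuperring.canonicalIdeal_le (hm : IsLocalSuperring m) : canonicalIdeal 𝒜 ≤ m :=
  Ideal.span_le.mpr fun _ hx => hm.odd_mem h2 hx

theorem IsLocalSuperring.nontrivial_superreduced (hm : IsLocalSuperring m) :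
    Nontrivial (Superreduced 𝒜) :=
  ⟨1, 0, fun h => hm.one_notMem (hm.canonicalIdeal_le h2 (Ideal.Quotient.eq_zero_iff_mem.mp
    ((map_one (Ideal.Quotient.mk (canonicalIdeal 𝒜))).trans h)))⟩

theorem IsLocalSuperring.isLocalRing_superreduced (hm : IsLocalSuperring m) :
    IsLocalRing (Superreduced 𝒜) := by
  have := hm.nontrivial_superreduced (𝒜 := 𝒜) h2
  obtain ⟨M, hM⟩ := Ideal.exists_maximal (Superreduced 𝒜)
  refine IsLocalRing.of_unique_max_ideal ⟨M, hM, fun M' hM' => ?_⟩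
  exact Ideal.comap_injective_of_surjective (Ideal.Quotient.mk (canonicalIdeal 𝒜))
    Ideal.Quotient.mk_surjective ((hm.comap_eq M' hM').trans (hm.comap_eq M hM).symm)

omit h2 in
theorem IsLocalSuperring.mem_maximalIdeal_iff (hm : IsLocalSuperring m)
    [IsLocalRing (Superreduced 𝒜)] {x : evenPart 𝒜} :
    evenToSuperreduced 𝒜 x ∈ IsLocalRing.maximalIdeal (Superreduced 𝒜) ↔ (x : R) ∈ m := by
  conv_rhs => rw [← hm.comap_eq _ (IsLocalRing.maximalIdeal.isMaximal (Superreduced 𝒜))]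
  rfl

theorem IsLocalSuperring.isUnit_of_notMem (hm : IsLocalSuperring m) {x : evenPart 𝒜}
    (hx : (x : R) ∉ m) : IsUnit x := by
  have := hm.isLocalRing_superreduced (𝒜 := 𝒜) h2
  refine isUnit_of_isUnit_map_of_ker_le_nilradical (evenToSuperreduced_surjective 𝒜)
    (ker_evenToSuperreduced_le_nilradical 𝒜 h2) ?_
  rw [← hm.mem_maximalIdeal_iff, IsLocalRing.mem_maximalIdeal, mem_nonunits_iff, not_not] at hx
  exact hx

theorem IsLocalSuperring.evenIdeal_le_jacobson (hm : IsLocalSuperring m) :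
    evenIdeal 𝒜 m ≤ Ideal.jacobson ⊥ := by
  intro x hx
  rw [Ideal.mem_jacobson_bot]
  intro y
  refine hm.isUnit_of_notMem h2 fun h => hm.one_notMem ?_
  have hxy : x * y ∈ evenIdeal 𝒜 m := Ideal.mul_mem_right _ _ hx
  have h' : x * y + 1 ∈ evenIdeal 𝒜 m := h
  have h1 : (1 : evenPart 𝒜) ∈ evenIdeal 𝒜 m := by simpa using sub_mem h' hxy
  exact h1

theorem IsLocalSuperring.isField_residueField (hm : IsLocalSuperring m) :
    IsField (residueField 𝒜 m) := by
  refine (Ideal.Quotient.maximal_ideal_iff_isField_quotient _).mp (Ideal.isMaximal_iff.mpr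
    ⟨hm.one_notMem, fun J x hJ hx hxJ => ?_⟩)
  exact (Ideal.eq_top_of_isUnit_mem J hxJ (hm.isUnit_of_notMem h2 hx)) ▸ Submodule.mem_top

end Local

/-! ### Even and odd cotangent spaces. -/

theorem finrank_eq_one_iff_of_isField {K V : Type*} [CommRing K] (hK : IsField K)
    [AddCommGroup V] [Module K V] :
    Module.finrank K V = 1 ↔ ∃ v : V, v ≠ 0 ∧ ∀ w : V, ∃ c : K, c • v = w := by
  let := hK.toField
  exact finrank_eq_one_iff'

theorem exists_basis_of_isField {K V : Type*} [CommRing K] (hK : IsField K)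
    [AddCommGroup V] [Module K V] [Module.Finite K V] :
    ∃ s : ℕ, Nonempty (Module.Basis (Fin s) K V) := by
  let := hK.toField
  exact ⟨_, ⟨Module.finBasis K V⟩⟩

section Cotangent

variable {R : Type*} [Ring R] {𝒜 : ZMod 2 → AddSubgroup R} [GradedRing 𝒜] [Supercommutative 𝒜]
  {m : Ideal R}

theorem IsLocalSuperring.mk_mem_mul (hm : IsLocalSuperring m) [IsLocalRing (Superreduced 𝒜)]
    {x : R} (hx : x ∈ m * m) : Ideal.Quotient.mk (canonicalIdeal 𝒜) x ∈
      IsLocalRing.maximalIdeal (Superreduced 𝒜) * IsLocalRing.maximalIdeal (Superreduced 𝒜) := by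
  have h : ∀ u ∈ m, Ideal.Quotient.mk (canonicalIdeal 𝒜) u ∈
      IsLocalRing.maximalIdeal (Superreduced 𝒜) := fun u hu => by
    rw [← hm.comap_eq _ (IsLocalRing.maximalIdeal.isMaximal (Superreduced 𝒜))] at hu
    exact hu
  induction hx using Submodule.smul_induction_on' with
  | smul u hu v hv =>
    rw [smul_eq_mul, map_mul]
    exact Ideal.mul_mem_mul (h u hu) (h v hv)
  | add u _ v _ hu hv => rw [map_add]; exact add_mem hu hv

variable (h2 : ∀ x : R, 2 * x = 0 → x = 0)
include h2

theorem IsLocalSuperring.mem_mul_of_mem_canonicalIdeal (hm : IsLocalSuperring m) {x : R}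
    (hx : x ∈ 𝒜 0) (hJ : x ∈ canonicalIdeal 𝒜) : x ∈ m * m := by
  refine (AddSubgroup.closure_le (m * m).toAddSubgroup).mpr ?_
    (mem_closure_of_even_of_mem_canonicalIdeal 𝒜 hx hJ)
  rintro _ ⟨u, hu, v, hv, rfl⟩
  exact Ideal.mul_mem_mul (hm.odd_mem h2 hu) (hm.odd_mem h2 hv)

/-- Phrasing the condition by elements of `R₀` and membership in `m²` allows comparison with `R̄`.
-/
theorem IsLocalSuperring.finrank_cotangent_zero_eq_one_iff (hm : IsLocalSuperring m) :
    Module.finrank (residueField 𝒜 m) (cotangent 𝒜 m 0) = 1 ↔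
      ∃ t : evenPart 𝒜, (t : R) ∈ m ∧ (t : R) ∉ m * m ∧
        ∀ x : evenPart 𝒜, (x : R) ∈ m → ∃ r : evenPart 𝒜, (x : R) - r * t ∈ m * m := by
  rw [finrank_eq_one_iff_of_isField (hm.isField_residueField h2)]
  have hz : ∀ x : idealComponent 𝒜 m 0,
      (Submodule.Quotient.mk x : cotangent 𝒜 m 0) = 0 ↔ (x : R) ∈ m * m := fun x => by
    rw [Submodule.Quotient.mk_eq_zero]
    exact ⟨fun h => h.1, fun h => ⟨h, x.2.2⟩⟩
  constructor
  · rintro ⟨v, hv, h⟩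
    obtain ⟨t, rfl⟩ := Submodule.Quotient.mk_surjective _ v
    refine ⟨⟨t, t.2.2⟩, t.2.1, fun ht => hv ((hz t).mpr ht), fun x hx => ?_⟩
    obtain ⟨c, hc⟩ := h (Submodule.Quotient.mk ⟨x, hx, x.2⟩)
    obtain ⟨r, rfl⟩ := Ideal.Quotient.mk_surjective c
    refine ⟨r, ?_⟩
    change Submodule.Quotient.mk (r • t) = _ at hc
    have h0 := (hz (⟨x, hx, x.2⟩ - r • t)).mp
      (by rw [Submodule.Quotient.mk_sub, hc, sub_self])
    exact h0
  · rintro ⟨t, ht, ht2, h⟩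
    refine ⟨Submodule.Quotient.mk ⟨t, ht, t.2⟩, fun h0 => ht2 ((hz _).mp h0), fun w => ?_⟩
    obtain ⟨x, rfl⟩ := Submodule.Quotient.mk_surjective _ w
    obtain ⟨r, hr⟩ := h ⟨x, x.2.2⟩ x.2.1
    refine ⟨Ideal.Quotient.mk _ r, ?_⟩
    have h0 := (hz (x - r • ⟨t, ht, t.2⟩)).mpr hr
    rw [Submodule.Quotient.mk_sub, sub_eq_zero] at h0
    exact h0.symm

theorem IsLocalSuperring.isDiscreteValuationRing_of_finrank_eq_one (hm : IsLocalSuperring m)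
    (hN : IsNoetherianSuperring 𝒜) [IsDomain (Superreduced 𝒜)]
    (h1 : Module.finrank (residueField 𝒜 m) (cotangent 𝒜 m 0) = 1) :
    IsDiscreteValuationRing (Superreduced 𝒜) := by
  obtain ⟨t, ht, ht2, h⟩ := (hm.finrank_cotangent_zero_eq_one_iff h2).mp h1
  have := hm.isLocalRing_superreduced (𝒜 := 𝒜) h2
  have := isNoetherianRing_superreduced 𝒜 hN
  set M := IsLocalRing.maximalIdeal (Superreduced 𝒜)
  set t' := evenToSuperreduced 𝒜 t
  have htM : t' ∈ M := hm.mem_maximalIdeal_iff.mpr ht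
  -- Nakayama: `M = (t') + M²`.
  have hle : M ≤ Ideal.span {t'} := by
    refine Submodule.le_of_le_smul_of_le_jacobson_bot (I := M) (IsNoetherian.noetherian M)
      (IsLocalRing.maximalIdeal_le_jacobson _) fun x hx => ?_
    obtain ⟨x, rfl⟩ := evenToSuperreduced_surjective 𝒜 x
    obtain ⟨r, hr⟩ := h x (hm.mem_maximalIdeal_iff.mp hx)
    rw [← add_sub_cancel (evenToSuperreduced 𝒜 r * t') (evenToSuperreduced 𝒜 x)]
    refine Submodule.add_mem_sup (Ideal.mul_mem_left _ _ (Ideal.mem_span_singleton_self _)) ?_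
    have := hm.mk_mem_mul (𝒜 := 𝒜) hr
    rwa [map_sub, map_mul] at this
  have hM : M = Ideal.span {t'} :=
    le_antisymm hle ((Ideal.span_singleton_le_iff_mem _).mpr htM)
  have hiff : M.IsPrincipal ↔ IsPrincipalIdealRing (Superreduced 𝒜) :=
    (tfae_of_isNoetherianRing_of_isLocalRing_of_isDomain (Superreduced 𝒜)).out 4 0
  have hP := hiff.mp ⟨⟨t', hM⟩⟩
  -- If `M = 0` then `t` is an even element of `J`, hence lies in `m²`.
  refine { not_a_field' := fun h0 => ht2 ?_ }
  have ht0 : t' ∈ (⊥ : Ideal (Superreduced 𝒜)) := h0 ▸ htM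
  exact hm.mem_mul_of_mem_canonicalIdeal h2 t.2 ((mem_ker_evenToSuperreduced 𝒜).mp ht0)

theorem IsLocalSuperring.finrank_cotangent_zero_eq_one (hm : IsLocalSuperring m)
    [IsDomain (Superreduced 𝒜)] [IsDiscreteValuationRing (Superreduced 𝒜)] :
    Module.finrank (residueField 𝒜 m) (cotangent 𝒜 m 0) = 1 := by
  rw [hm.finrank_cotangent_zero_eq_one_iff h2]
  obtain ⟨t', ht'⟩ := IsDiscreteValuationRing.exists_irreducible (Superreduced 𝒜)
  have hM := ht'.maximalIdeal_eq
  obtain ⟨t, rfl⟩ := evenToSuperreduced_surjective 𝒜 t'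
  have htM : evenToSuperreduced 𝒜 t ∈ IsLocalRing.maximalIdeal (Superreduced 𝒜) :=
    hM ▸ Ideal.mem_span_singleton_self _
  refine ⟨t, hm.mem_maximalIdeal_iff.mp htM, fun ht2 => ?_, fun x hx => ?_⟩
  · have h := hm.mk_mem_mul (𝒜 := 𝒜) ht2
    rw [hM, Ideal.span_singleton_mul_span_singleton, Ideal.mem_span_singleton] at h
    obtain ⟨c, hc⟩ := h
    change evenToSuperreduced 𝒜 t = _ at hc
    refine ht'.not_isUnit (IsUnit.of_mul_eq_one c (mul_left_cancel₀ ht'.ne_zero ?_))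
    rw [← mul_assoc, ← hc, mul_one]
  · have h := hm.mem_maximalIdeal_iff.mpr hx
    rw [hM, Ideal.mem_span_singleton'] at h
    obtain ⟨r, hr⟩ := h
    obtain ⟨r, rfl⟩ := evenToSuperreduced_surjective 𝒜 r
    refine ⟨r, hm.mem_mul_of_mem_canonicalIdeal h2 (x - r * t).2
      ((mem_ker_evenToSuperreduced 𝒜 (x := x - r * t)).mp ?_)⟩
    rw [RingHom.mem_ker, map_sub, map_mul, hr, sub_self]

/-- The odd part of `m²` is `m₀ R₁`. -/
theorem IsLocalSuperring.exists_smul_of_mem_mul (hm : IsLocalSuperring m) {x : R}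
    (hx : x ∈ m * m) : ∃ a ∈ 𝒜 0, ∃ b ∈ evenIdeal 𝒜 m • (⊤ : Submodule (evenPart 𝒜) (component 𝒜 1)),
      x = a + b := by
  induction hx using Submodule.smul_induction_on' with
  | smul u hu v hv =>
    obtain ⟨u₀, hu₀, u₁, hu₁, rfl⟩ := decompose_two 𝒜 u
    obtain ⟨v₀, hv₀, v₁, hv₁, rfl⟩ := decompose_two 𝒜 v
    have hu' : u₀ ∈ m := by simpa using sub_mem hu (hm.odd_mem h2 hu₁)
    have hv' : v₀ ∈ m := by simpa using sub_mem hv (hm.odd_mem h2 hv₁)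
    refine ⟨u₀ * v₀ + u₁ * v₁, add_mem (even_mul_even_mem 𝒜 hu₀ hv₀)
      (odd_mul_odd_mem 𝒜 hu₁ hv₁),
      (⟨u₀, hu₀⟩ : evenPart 𝒜) • (⟨v₁, hv₁⟩ : component 𝒜 1) +
        (⟨v₀, hv₀⟩ : evenPart 𝒜) • (⟨u₁, hu₁⟩ : component 𝒜 1),
      add_mem (Submodule.smul_mem_smul hu' Submodule.mem_top)
        (Submodule.smul_mem_smul hv' Submodule.mem_top), ?_⟩
    change (u₀ + u₁) * (v₀ + v₁) = u₀ * v₀ + u₁ * v₁ + (u₀ * v₁ + v₀ * u₁)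
    rw [even_mul_comm 𝒜 1 hv₀ hu₁]
    noncomm_ring
  | add p _ q _ hp hq =>
    obtain ⟨a, ha, b, hb, rfl⟩ := hp
    obtain ⟨a', ha', b', hb', rfl⟩ := hq
    exact ⟨a + a', add_mem ha ha', b + b', add_mem hb hb', by rw [Submodule.coe_add]; abel⟩

/-- Odd lifts of a basis of `(m / m²)₁` generate `R₁`. -/
theorem IsLocalSuperring.span_oddLift_eq_top (hm : IsLocalSuperring m)
    (hN : IsNoetherianSuperring 𝒜) {s : ℕ}
    {b : Module.Basis (Fin s) (residueField 𝒜 m) (cotangent 𝒜 m 1)}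
    {z : Fin s → idealComponent 𝒜 m 1} (hz : IsOddLift 𝒜 m b z) :
    Submodule.span (evenPart 𝒜)
      (Set.range fun i => (⟨z i, (z i).2.2⟩ : component 𝒜 1)) = ⊤ := by
  have := isNoetherian_component 𝒜 hN 1
  refine top_le_iff.mp (Submodule.le_of_le_smul_of_le_jacobson_bot
    (I := evenIdeal 𝒜 m) (IsNoetherian.noetherian ⊤) (hm.evenIdeal_le_jacobson h2) fun x _ => ?_)
  let x' : idealComponent 𝒜 m 1 := ⟨x, hm.odd_mem h2 x.2, x.2⟩
  choose c hc using fun i => Ideal.Quotient.mk_surjective (b.repr (Submodule.Quotient.mk x') i)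
  have hsum : (Submodule.Quotient.mk (∑ i, c i • z i) : cotangent 𝒜 m 1) =
      Submodule.Quotient.mk x' := by
    rw [← b.sum_repr (Submodule.Quotient.mk x'), ← Submodule.mkQ_apply, map_sum]
    refine Finset.sum_congr rfl fun i _ => ?_
    rw [← hc i, ← hz i]
    rfl
  have hmem := ((Submodule.Quotient.eq _).mp hsum.symm).1
  have hco : ((x' - ∑ i, c i • z i : idealComponent 𝒜 m 1) : R) =
      ((x - ∑ i, c i • (⟨z i, (z i).2.2⟩ : component 𝒜 1) : component 𝒜 1) : R) := by
    simp [x']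
  obtain ⟨a, ha, d, hd, had⟩ := hm.exists_smul_of_mem_mul (𝒜 := 𝒜) h2 hmem
  -- The difference and `d` are both odd, so the even term `a` is odd too and must vanish.
  have ha1 : a ∈ 𝒜 1 := by
    rw [← sub_eq_iff_eq_add] at had
    rw [← had]
    exact sub_mem (x' - ∑ i, c i • z i).2.2 d.2
  rw [eq_zero_of_mem_of_mem 𝒜 (by decide) ha ha1, zero_add] at had
  rw [← add_sub_cancel (∑ i, c i • (⟨z i, (z i).2.2⟩ : component 𝒜 1)) x]
  refine Submodule.add_mem_sup (Submodule.sum_mem _ fun i _ => Submodule.smul_mem _ _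
    (Submodule.subset_span ⟨i, rfl⟩)) ?_
  rwa [Subtype.ext (hco.symm.trans had)]

end Cotangent

/-! ### Regular elements. -/

section Regular

variable {R : Type*} [Ring R] {𝒜 : ZMod 2 → AddSubgroup R} [GradedRing 𝒜]

theorem prod_ofFn_mem {n : ℕ} {a : Fin n → R} (ha : ∀ i, a i ∈ 𝒜 1) :
    SetLike.IsHomogeneousElem 𝒜 (List.ofFn a).prod :=
  ⟨_, SetLike.list_prod_ofFn_mem_graded (fun _ => 1) a ha⟩

/-- The even part of a regular element is regular. -/
theorem IsRegularElement.even_part [Supercommutative 𝒜]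
    (h2 : ∀ x : R, 2 * x = 0 → x = 0) {a b : R} (ha : a ∈ 𝒜 0) (hb : b ∈ 𝒜 1)
    (h : IsRegularElement 𝒜 (a + b)) : IsRegularElement 𝒜 a := by
  rintro y ⟨i, hy⟩ hay
  -- `a + b` kills `b * y`, since `a * b * y = b * a * y = 0` and `b * b = 0`.
  have hby : b * y = 0 := by
    refine h _ ⟨1 + i, SetLike.mul_mem_graded hb hy⟩ ?_
    rw [add_mul, ← mul_assoc, ← mul_assoc, even_mul_comm 𝒜 1 ha hb, mul_assoc, hay, mul_zero,
      odd_mul_self 𝒜 h2 hb, zero_mul, add_zero]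
  exact h y ⟨i, hy⟩ (by rw [add_mul, hay, hby, add_zero])

/-- Regularity is tested on homogeneous elements only, so the induction also carries the degree of
`a ^ n * y`. -/
theorem IsRegularElement.pow_mul_ne_zero {a y : R} (ha : a ∈ 𝒜 0) (h : IsRegularElement 𝒜 a)
    (hy : SetLike.IsHomogeneousElem 𝒜 y) (hy0 : y ≠ 0) (n : ℕ) : a ^ n * y ≠ 0 := by
  obtain ⟨i, hy⟩ := hy
  have key : a ^ n * y ∈ 𝒜 i ∧ a ^ n * y ≠ 0 := by
    induction n with
    | zero => simpa using ⟨hy, hy0⟩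
    | succ n ih =>
      rw [pow_succ', mul_assoc]
      exact ⟨by simpa using SetLike.mul_mem_graded ha ih.1, fun h0 => ih.2 (h _ ⟨i, ih.1⟩ h0)⟩
  exact key.2

end Regular

/-! ### Systems of odd parameters. -/

section Parameters

variable {R : Type*} [Ring R] {𝒜 : ZMod 2 → AddSubgroup R} [GradedRing 𝒜] [Supercommutative 𝒜]
  {m : Ideal R}

/-- A zero product has annihilator `R₀`; the zero ring has dimension `⊥`, while the nontrivial `R₀`
has dimension at least `0`. -/
theorem IsSystemOfOddParameters.prod_ne_zero {n : ℕ} {a : Fin n → R}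
    [Nontrivial (evenPart 𝒜)] (h : IsSystemOfOddParameters 𝒜 a) : (List.ofFn a).prod ≠ 0 := by
  intro h0
  have hd := h.2
  rw [h0, Ideal.torsionOf_zero] at hd
  have hs : Subsingleton (evenPart 𝒜 ⧸ (⊤ : Ideal (evenPart 𝒜))) :=
    Ideal.Quotient.subsingleton_iff.mpr rfl
  rw [ringKrullDim_eq_bot_of_subsingleton (R := evenPart 𝒜 ⧸ (⊤ : Ideal (evenPart 𝒜)))] at hd
  exact (lt_of_lt_of_le (WithBot.bot_lt_coe _) ringKrullDim_nonneg_of_nontrivial).ne' hd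

omit [Supercommutative 𝒜] in
theorem IsLocalSuperring.nontrivial_evenPart (hm : IsLocalSuperring m) :
    Nontrivial (evenPart 𝒜) :=
  ⟨1, 0, fun h => hm.one_notMem (by
    rw [show (1 : R) = 0 from congrArg Subtype.val h]
    exact m.zero_mem)⟩

variable (h2 : ∀ x : R, 2 * x = 0 → x = 0)
include h2

/-- Every system of odd parameters has length at most `s`, and even less than `s` if
`z₁ ⋯ z_s = 0`, when `z₁, …, z_s` generate `R₁`. -/
theorem IsSystemOfOddParameters.length_le [Nontrivial (evenPart 𝒜)] {s n : ℕ}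
    {z : Fin s → component 𝒜 1} (hz : Submodule.span (evenPart 𝒜) (Set.range z) = ⊤)
    {a : Fin n → R} (h : IsSystemOfOddParameters 𝒜 a) :
    n ≤ s ∧ ((List.ofFn fun i => (z i : R)).prod = 0 → n < s) := by
  have key := fun hsn hz0 => h.prod_ne_zero
    (prod_odd_eq_zero h2 (n := n) hz hsn hz0 fun i => ⟨a i, h.1 i⟩)
  refine ⟨le_of_not_gt fun hlt => key hlt.le fun he => absurd he hlt.ne, fun h0 => ?_⟩
  exact lt_of_not_ge fun hle => key hle fun _ => h0

/-- An odd factor in front of `z₁⋯z_s` makes a product of `s + 1` odd elements. -/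
theorem canonicalIdeal_mul_prod {s : ℕ} {z : Fin s → component 𝒜 1}
    (hz : Submodule.span (evenPart 𝒜) (Set.range z) = ⊤) {x : R} (hx : x ∈ canonicalIdeal 𝒜) :
    x * (List.ofFn fun i => (z i : R)).prod = 0 := by
  induction hx using Submodule.closure_induction with
  | zero => exact zero_mul _
  | add p q _ _ hp hq => rw [add_mul, hp, hq, add_zero]
  | smul_mem r x hx =>
    have h := prod_odd_eq_zero h2 (n := s + 1) hz (Nat.le_succ s)
      (fun he => absurd he (Nat.lt_succ_self s).ne) (Fin.cons ⟨x, hx⟩ z)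
    rw [List.ofFn_succ, List.prod_cons] at h
    rw [smul_eq_mul, mul_assoc]
    exact (congrArg (r * ·) h).trans (mul_zero r)

/-- If `R̄` is a discrete valuation ring, `m` is regular, and the generators `z₁, …, z_s` of `R₁`
have nonzero product, then they form a system of odd parameters. -/
theorem IsLocalSuperring.isSystemOfOddParameters (hm : IsLocalSuperring m)
    (hreg : IsRegularIdeal 𝒜 m) [IsDomain (Superreduced 𝒜)]
    [IsDiscreteValuationRing (Superreduced 𝒜)] {s : ℕ} {z : Fin s → component 𝒜 1}
    (hz : Submodule.span (evenPart 𝒜) (Set.range z) = ⊤)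
    (hz0 : (List.ofFn fun i => (z i : R)).prod ≠ 0) :
    IsSystemOfOddParameters 𝒜 fun i => (z i : R) := by
  refine ⟨fun i => (z i).2, ?_⟩
  rw [show Ideal.torsionOf (evenPart 𝒜) R (List.ofFn fun i => (z i : R)).prod =
    RingHom.ker (evenToSuperreduced 𝒜) from ?_, ringKrullDim_evenPart_quotient_ker 𝒜 h2]
  refine le_antisymm (fun x hx => ?_) fun x hx =>
    canonicalIdeal_mul_prod h2 hz ((mem_ker_evenToSuperreduced 𝒜).mp hx)
  by_contra hx0
  obtain ⟨a, ham, hreg⟩ := hreg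
  obtain ⟨a, ha, b, hb, rfl⟩ := decompose_two 𝒜 a
  have ham' : a ∈ m := by simpa using sub_mem ham (hm.odd_mem h2 hb)
  obtain ⟨t, ht⟩ := IsDiscreteValuationRing.exists_irreducible (Superreduced 𝒜)
  obtain ⟨k, hk⟩ := IsDiscreteValuationRing.associated_pow_irreducible hx0 ht
  have hat : t ∣ evenToSuperreduced 𝒜 ⟨a, ha⟩ := by
    rw [← Ideal.mem_span_singleton, ← ht.maximalIdeal_eq]
    exact hm.mem_maximalIdeal_iff.mpr ham'
  -- In `R̄`, `x` is associated to `t ^ k`, which divides `a ^ k` because `a ∈ m`; so `a ^ k - r *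
  -- x` lies in `J` and kills `z₁⋯z_s`.
  obtain ⟨r, hr⟩ := hk.dvd.trans (pow_dvd_pow_of_dvd hat k)
  obtain ⟨r, rfl⟩ := evenToSuperreduced_surjective 𝒜 r
  have hker : (⟨a, ha⟩ ^ k - r * x : evenPart 𝒜) ∈ RingHom.ker (evenToSuperreduced 𝒜) := by
    rw [RingHom.mem_ker, map_sub, map_mul, map_pow, hr, mul_comm, sub_self]
  have h0 := canonicalIdeal_mul_prod h2 hz ((mem_ker_evenToSuperreduced 𝒜).mp hker)
  have hx' : (x : R) * (List.ofFn fun i => (z i : R)).prod = 0 := hx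
  change (a ^ k - (r : R) * x) * _ = 0 at h0
  rw [sub_mul, mul_assoc, hx', mul_zero, sub_zero] at h0
  exact (hreg.even_part h2 ha hb).pow_mul_ne_zero ha (prod_ofFn_mem fun i => (z i).2) hz0 k h0

/-! ### Assembling the equivalences. -/

theorem IsLocalSuperring.exists_oddLift (hm : IsLocalSuperring m)
    (hN : IsNoetherianSuperring 𝒜) :
    ∃ (s : ℕ) (b : Module.Basis (Fin s) (residueField 𝒜 m) (cotangent 𝒜 m 1))
      (z : Fin s → idealComponent 𝒜 m 1), IsOddLift 𝒜 m b z := by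
  have := isNoetherian_component 𝒜 hN 1
  have hfin : Module.Finite (evenPart 𝒜) (idealComponent 𝒜 m 1) :=
    Module.Finite.of_injective (Submodule.inclusion (inf_le_right : _ ≤ component 𝒜 1))
      (Submodule.inclusion_injective _)
  have hfin' : Module.Finite (residueField 𝒜 m) (cotangent 𝒜 m 1) := by
    obtain ⟨S, hS⟩ := Module.Finite.fg_top (R := evenPart 𝒜) (M := cotangent 𝒜 m 1)
    refine ⟨S, top_le_iff.mp fun x _ => ?_⟩
    have hx : x ∈ Submodule.span (evenPart 𝒜) (S : Set (cotangent 𝒜 m 1)) :=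
      hS ▸ Submodule.mem_top
    induction hx using Submodule.span_induction with
    | mem x hx => exact Submodule.subset_span hx
    | zero => exact zero_mem _
    | add x y _ _ hx hy => exact add_mem (hx trivial) (hy trivial)
    | smul r x _ hx => exact Submodule.smul_mem _ (Ideal.Quotient.mk _ r) (hx trivial)
  obtain ⟨s, ⟨b⟩⟩ := exists_basis_of_isField (hm.isField_residueField (𝒜 := 𝒜) h2)
    (V := cotangent 𝒜 m 1)
  choose z hz using fun i => Submodule.Quotient.mk_surjective _ (b i)
  exact ⟨s, b, z, hz⟩

theorem IsLocalSuperring.finrank_eq_card (hm : IsLocalSuperring m) {s : ℕ}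
    (b : Module.Basis (Fin s) (residueField 𝒜 m) (cotangent 𝒜 m 1)) :
    Module.finrank (residueField 𝒜 m) (cotangent 𝒜 m 1) = s := by
  have := (hm.isField_residueField (𝒜 := 𝒜) h2).nontrivial
  rw [Module.finrank_eq_card_basis b, Fintype.card_fin]

theorem IsLocalSuperring.isDiscreteValuationSuperring_of_prod_ne_zero (hm : IsLocalSuperring m)
    (hN : IsNoetherianSuperring 𝒜) (hreg : IsRegularIdeal 𝒜 m) (hD : SuperreducedIsDVR 𝒜)
    {s : ℕ} {b : Module.Basis (Fin s) (residueField 𝒜 m) (cotangent 𝒜 m 1)}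
    {z : Fin s → idealComponent 𝒜 m 1} (hz : IsOddLift 𝒜 m b z)
    (hz0 : (List.ofFn fun i => (z i : R)).prod ≠ 0) : IsDiscreteValuationSuperring 𝒜 := by
  obtain ⟨hdom, hD⟩ := hD
  have := hm.nontrivial_evenPart (𝒜 := 𝒜)
  have hspan := hm.span_oddLift_eq_top h2 hN hz
  -- The odd dimension is at most `s` because the lifts generate `R₁`, and the lifts themselves
  -- attain it.
  have hK : Ksdim 𝒜 = (1, (s : ℕ∞)) := by
    refine Prod.ext ?_ (le_antisymm (iSup₂_le fun n hn => ?_) ?_)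
    · exact (ringKrullDim_superreduced 𝒜 h2).symm.trans
        (IsDiscreteValuationRing.ringKrullDim_eq_one _)
    · obtain ⟨a, ha⟩ := hn
      exact Nat.cast_le.mpr (ha.length_le h2 hspan).1
    · exact le_iSup₂_of_le (f := fun (n : ℕ)
        (_ : ∃ a : Fin n → R, IsSystemOfOddParameters 𝒜 a) => (n : ℕ∞)) s
        ⟨_, hm.isSystemOfOddParameters h2 hreg hspan hz0⟩ le_rfl
  refine ⟨m, hm, hN, hdom, ?_, s, hK⟩
  rw [IsRegularLocal, hK, cotangentSdim, hm.finrank_cotangent_zero_eq_one h2,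
    hm.finrank_eq_card h2 b, Nat.cast_one]

theorem IsLocalSuperring.superreducedIsDVR (hm : IsLocalSuperring m)
    (h : IsDiscreteValuationSuperring 𝒜) : SuperreducedIsDVR 𝒜 := by
  obtain ⟨m', hm', hN, hdom, hreg, N, hK⟩ := h
  obtain rfl := hm.2 m' hm'.1
  have hd : IsDomain (Superreduced 𝒜) := hdom
  refine ⟨hd, hm'.isDiscreteValuationRing_of_finrank_eq_one h2 hN ?_⟩
  have h1 := congrArg Prod.fst (hK.symm.trans hreg)
  exact (Nat.cast_eq_one (R := WithBot ℕ∞)).mp h1.symm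

theorem IsLocalSuperring.prod_oddLift_ne_zero (hm : IsLocalSuperring m)
    (h : IsDiscreteValuationSuperring 𝒜) {s : ℕ}
    {b : Module.Basis (Fin s) (residueField 𝒜 m) (cotangent 𝒜 m 1)}
    {z : Fin s → idealComponent 𝒜 m 1} (hz : IsOddLift 𝒜 m b z) :
    (List.ofFn fun i => (z i : R)).prod ≠ 0 := by
  obtain ⟨m', hm', hN, -, hreg, -⟩ := h
  obtain rfl := hm.2 m' hm'.1
  have := hm.nontrivial_evenPart (𝒜 := 𝒜)
  have hspan := hm.span_oddLift_eq_top h2 hN hz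
  intro h0
  have hs : (Ksdim 𝒜).2 = s := by
    rw [hreg]
    exact congrArg _ (hm.finrank_eq_card h2 b)
  -- With truncated subtraction, `s ≤ s - 1` leaves only `s = 0`, where the empty product is `1 ≠
  -- 0`.
  have hle : (Ksdim 𝒜).2 ≤ ((s - 1 : ℕ) : ℕ∞) := iSup₂_le fun n ⟨a, ha⟩ =>
    Nat.cast_le.mpr (Nat.le_sub_one_of_lt ((ha.length_le h2 hspan).2 h0))
  rw [hs, Nat.cast_le] at hle
  obtain rfl : s = 0 := by omega
  rw [List.ofFn_zero, List.prod_nil] at h0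
  exact hm.one_notMem (h0 ▸ m'.zero_mem)

end Parameters

end Superring

theorem theorem5p9 {R : Type*} [Ring R] (𝒜 : ZMod 2 → AddSubgroup R) [GradedRing 𝒜]
    [Superring.Supercommutative 𝒜] (h2 : ∀ x : R, 2 * x = 0 → x = 0)
    (m : Ideal R) (hloc : Superring.IsLocalSuperring m) (hnoeth : Superring.IsNoetherianSuperring 𝒜)
    (hreg : Superring.IsRegularIdeal 𝒜 m) :
    (Superring.IsDiscreteValuationSuperring 𝒜 ↔
      Superring.SuperreducedIsDVR 𝒜 ∧
        ∃ (s : ℕ) (b : Module.Basis (Fin s) (Superring.residueField 𝒜 m)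
            (Superring.cotangent 𝒜 m 1)) (z : Fin s → Superring.idealComponent 𝒜 m 1),
          Superring.IsOddLift 𝒜 m b z ∧ (List.ofFn fun i => (z i : R)).prod ≠ 0) ∧
    (Superring.IsDiscreteValuationSuperring 𝒜 ↔
      Superring.SuperreducedIsDVR 𝒜 ∧
        ∀ (s : ℕ) (b : Module.Basis (Fin s) (Superring.residueField 𝒜 m)
            (Superring.cotangent 𝒜 m 1)) (z : Fin s → Superring.idealComponent 𝒜 m 1),
          Superring.IsOddLift 𝒜 m b z → (List.ofFn fun i => (z i : R)).prod ≠ 0) := by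
  refine ⟨⟨fun h => ⟨hloc.superreducedIsDVR h2 h, ?_⟩, ?_⟩,
    ⟨fun h => ⟨hloc.superreducedIsDVR h2 h, fun s b z hz => hloc.prod_oddLift_ne_zero h2 h hz⟩, ?_⟩⟩
  · obtain ⟨s, b, z, hz⟩ := hloc.exists_oddLift h2 hnoeth
    exact ⟨s, b, z, hz, hloc.prod_oddLift_ne_zero h2 h hz⟩
  · rintro ⟨hD, s, b, z, hz, hz0⟩
    exact hloc.isDiscreteValuationSuperring_of_prod_ne_zero h2 hnoeth hreg hD hz hz0
  · rintro ⟨hD, h⟩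
    obtain ⟨s, b, z, hz⟩ := hloc.exists_oddLift h2 hnoeth
    exact hloc.isDiscreteValuationSuperring_of_prod_ne_zero h2 hnoeth hreg hD hz (h s b z hz)
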